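/- Throughout, a trace on a unital C*-algebra $A$ is a tracial state, $T(A)$ is the set of traces with the weak* topology, and $T(A)$ is called a Bauer simplex if its extreme boundary $\partial_e T(A)$ is compact and non-empty. Put $\|a\|_{2,T(A)}=\sup_{\tau\in T(A)}\tau(a^*a)^{1/2}$. For a free ultrafilter $\omega$ on $\mathbb N$ let $$A^\omega=\ell^\infty(A)/\{(a_m)_m:\lim_{m\to\omega}\|a_m\|_{2,T(A)}=0\},$$ let $\iota:A\to A^\omega$ be the map given by constant sequences, and let $T_\omega(A)$ be the set of limit traces $[(a_m)_m]\mapsto\lim_{m\to\omega}\tau_m(a_m)$ on $A^\omega$, where $(\tau_m)_m$ is a sequence in $T(A)$. A separable unital C*-algebra $A$ with $T(A)$ non-empty (hence compact) has uniform property $\Gamma$ (with respect to $\omega$) if for every $n\ge 1$ there are projections $p_1,\dots,p_n\in A^\omega\cap\iota(A)'$ with $p_1+\dots+p_n=1$ and $\tau(\iota(a)p_i)=\frac1n\tau(\iota(a))$ for all $a\in A$, $\tau\in T_\omega(A)$ and $i=1,\dots,n$. For compact Hausdorff spaces $X,Y$, a $*$-homomorphism $\phi: C(X)\to M_k\otimes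 C(Y)$ is diagonal if there are continuous maps $\lambda_1,\dots,\lambda_k:Y\to X$ and matrix units $e_{rs}\in M_k$ with $\phi(f)=\sum_{r=1}^k e_{rr}\otimes(f\circ\lambda_r)$ for all $f\in C(X)$. Matrix amplifications $M_m\otimes C(X)\to M_m\otimes M_k\otimes C(Y)\cong M_{mk}\otimes C(Y)$ of diagonal maps are also called diagonal. **Proposition.** Let $A$ be the C*-algebra inductive limit of a sequence $$M_{n_1}\otimes C(X_1)\xrightarrow{\phi_1}M_{n_2}\otimes C(X_2)\xrightarrow{\phi_2}M_{n_3}\otimes C(X_3)\to\cdots,$$ where the $X_i$ are compact Hausdorff spaces, the connecting maps $\phi_i$ are diagonal and $n_i\to\infty$. Suppose that $A$ is separable and that $T(A)$ is a Bauer simplex. Then $A$ has uniform property $\Gamma$ (with respect to every free ultrafilter $\omega$ on $\mathbb N$). -/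

import Mathlib

open Filter Topology
open scoped ComplexOrder BoundedContinuousFunction

noncomputable section

/-! ### Traces on a unital C*-algebra -/

/-- `T(A)`: the tracial states of the unital C*-algebra `A` (positive, unital, tracial
functionals), a subset of the dual of `A` with the weak* topology. -/
def traceSpace (A : Type*) [CStarAlgebra A] : Set (WeakDual ℂ A) :=
  {τ | (∀ a, 0 ≤ τ (star a * a)) ∧ τ 1 = 1 ∧ ∀ a b, τ (a * b) = τ (b * a)}

/-- `T(A)` is a Bauer simplex: its extreme boundary is compact and non-empty. (The tracial states
of a unital C*-algebra always form a compact Choquet simplex.) -/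
def TraceSpaceIsBauer (A : Type*) [CStarAlgebra A] : Prop :=
  IsCompact ((traceSpace A).extremePoints ℝ) ∧ ((traceSpace A).extremePoints ℝ).Nonempty

/-- The uniform 2-seminorm `‖a‖_{2,T(A)} = sup_{τ ∈ T(A)} τ(a* a)^{1/2}`. -/
def uniformTraceNorm {A : Type*} [CStarAlgebra A] (a : A) : ℝ :=
  ⨆ τ : traceSpace A, √((τ : WeakDual ℂ A) (star a * a)).re

section TraceLemmas

variable {A : Type*} [CStarAlgebra A]

theorem traceSpace_star {τ : WeakDual ℂ A} (hτ : τ ∈ traceSpace A) (a : A) :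
    τ (star a) = star (τ a) := by
  have h1 := (Complex.le_def.1 (hτ.1 (a + 1))).2
  have h2 := (Complex.le_def.1 (hτ.1 (a + Complex.I • (1 : A)))).2
  have h0 := (Complex.le_def.1 (hτ.1 a)).2
  simp only [star_add, star_one, star_smul, add_mul, mul_add, mul_one, one_mul, smul_mul_assoc,
    mul_smul_comm, map_add, map_smul, hτ.2.1, Complex.add_im, smul_eq_mul, Complex.mul_im,
    Complex.zero_im, Complex.one_im, Complex.star_def, Complex.conj_I,
    Complex.neg_re, Complex.neg_im, Complex.I_re, Complex.I_im] at h1 h2 h0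
  apply Complex.ext
  · simp only [Complex.star_def, Complex.conj_re]; linarith
  · simp only [Complex.star_def, Complex.conj_im]; linarith

theorem traceSpace_conj_le {τ : WeakDual ℂ A} (hτ : τ ∈ traceSpace A) (x a : A) :
    (τ (star (x * a) * (x * a))).re ≤ ‖x‖ ^ 2 * (τ (star a * a)).re := by
  let _ := CStarAlgebra.spectralOrder A
  have := CStarAlgebra.spectralOrderedRing A
  have h : 0 ≤ (algebraMap ℝ A) (‖x‖ ^ 2) - star x * x :=
    sub_nonneg.2 CStarAlgebra.star_mul_le_algebraMap_norm_sq
  obtain ⟨y, hy⟩ := CStarAlgebra.nonneg_iff_eq_star_mul_self.1 h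
  have h1 := (Complex.le_def.1 (hτ.1 (y * a))).1
  have h2 : star (y * a) * (y * a) =
      ((‖x‖ ^ 2 : ℝ) : ℂ) • (star a * a) - star (x * a) * (x * a) := by
    have : star (y * a) * (y * a) = star a * (star y * y) * a := by
      simp only [star_mul, mul_assoc]
    rw [this, ← hy, mul_sub, sub_mul, Algebra.algebraMap_eq_smul_one]
    simp only [star_mul, mul_assoc, mul_smul_comm, smul_mul_assoc, mul_one]
    rw [Complex.coe_smul]
  rw [h2, map_sub, map_smul, smul_eq_mul, Complex.sub_re, Complex.re_ofReal_mul] at h1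
  simp only [Complex.zero_re] at h1
  linarith

theorem traceSpace_sq_le {τ : WeakDual ℂ A} (hτ : τ ∈ traceSpace A) (a : A) :
    (τ (star a * a)).re ≤ ‖a‖ ^ 2 := by
  have := traceSpace_conj_le hτ a 1
  simpa [hτ.2.1] using this

theorem sqrt_trace_le {τ : WeakDual ℂ A} (hτ : τ ∈ traceSpace A) (a : A) :
    √(τ (star a * a)).re ≤ uniformTraceNorm a := by
  refine le_ciSup (f := fun τ : traceSpace A => √((τ : WeakDual ℂ A) (star a * a)).re)
    ⟨‖a‖, ?_⟩ ⟨τ, hτ⟩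
  rintro _ ⟨σ, rfl⟩
  exact Real.sqrt_le_iff.2 ⟨norm_nonneg a, traceSpace_sq_le σ.2 a⟩

theorem uniformTraceNorm_nonneg (a : A) : 0 ≤ uniformTraceNorm a :=
  Real.iSup_nonneg fun _ => Real.sqrt_nonneg _

theorem trace_le_uniform_sq {τ : WeakDual ℂ A} (hτ : τ ∈ traceSpace A) (a : A) :
    (τ (star a * a)).re ≤ uniformTraceNorm a ^ 2 :=
  (Real.sqrt_le_left (uniformTraceNorm_nonneg a)).1 (sqrt_trace_le hτ a)

theorem uniformTraceNorm_le {a : A} {c : ℝ} (hc : 0 ≤ c)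
    (h : ∀ τ ∈ traceSpace A, (τ (star a * a)).re ≤ c ^ 2) : uniformTraceNorm a ≤ c :=
  Real.iSup_le (fun τ => Real.sqrt_le_iff.2 ⟨hc, h τ τ.2⟩) hc

theorem uniformTraceNorm_zero : uniformTraceNorm (0 : A) = 0 :=
  le_antisymm (uniformTraceNorm_le le_rfl fun τ _ => by simp) (uniformTraceNorm_nonneg _)

theorem uniformTraceNorm_star (a : A) : uniformTraceNorm (star a) = uniformTraceNorm a := by
  unfold uniformTraceNorm
  congr 1
  funext τ
  rw [star_star, τ.2.2.2]

theorem uniformTraceNorm_mul_left (x a : A) :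
    uniformTraceNorm (x * a) ≤ ‖x‖ * uniformTraceNorm a := by
  refine uniformTraceNorm_le (mul_nonneg (norm_nonneg _) (uniformTraceNorm_nonneg _)) ?_
  intro τ hτ
  refine (traceSpace_conj_le hτ x a).trans ?_
  rw [mul_pow]
  exact mul_le_mul_of_nonneg_left (trace_le_uniform_sq hτ a) (sq_nonneg _)

theorem uniformTraceNorm_mul_right (a x : A) :
    uniformTraceNorm (a * x) ≤ ‖x‖ * uniformTraceNorm a := by
  rw [← uniformTraceNorm_star, star_mul, ← norm_star x, ← uniformTraceNorm_star a]
  exact uniformTraceNorm_mul_left _ _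

theorem uniformTraceNorm_add (a b : A) :
    uniformTraceNorm (a + b) ≤ 2 * (uniformTraceNorm a + uniformTraceNorm b) := by
  have ha := uniformTraceNorm_nonneg a
  have hb := uniformTraceNorm_nonneg b
  refine uniformTraceNorm_le (by positivity) fun τ hτ => ?_
  have h1 := (Complex.le_def.1 (hτ.1 (a - b))).1
  have h2 := trace_le_uniform_sq hτ a
  have h3 := trace_le_uniform_sq hτ b
  simp only [star_add, star_sub, add_mul, mul_add, sub_mul, mul_sub, map_add, map_sub,
    Complex.add_re, Complex.sub_re, Complex.zero_re] at h1 ⊢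
  nlinarith [mul_nonneg ha hb]

theorem norm_trace_le {τ : WeakDual ℂ A} (hτ : τ ∈ traceSpace A) (a : A) :
    ‖τ a‖ ≤ uniformTraceNorm a := by
  refine le_trans (Real.le_sqrt_of_sq_le ?_) (sqrt_trace_le hτ a)
  have h1 := (Complex.le_def.1 (hτ.1 (a - (τ a) • (1 : A)))).1
  simp only [star_sub, star_smul, star_one, sub_mul, mul_sub, smul_mul_assoc, mul_smul_comm,
    one_mul, mul_one, map_sub, map_smul, hτ.2.1, traceSpace_star hτ, smul_eq_mul,
    Complex.star_def, Complex.sub_re, Complex.zero_re, Complex.mul_re, Complex.conj_re,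
    Complex.conj_im] at h1
  rw [← Complex.normSq_eq_norm_sq, Complex.normSq_apply]
  linarith

theorem norm_trace_le_norm {τ : WeakDual ℂ A} (hτ : τ ∈ traceSpace A) (a : A) :
    ‖τ a‖ ≤ ‖a‖ :=
  (norm_trace_le hτ a).trans
    (uniformTraceNorm_le (norm_nonneg _) fun _ hσ => traceSpace_sq_le hσ a)

end TraceLemmas

/-! ### The uniform tracial ultrapower -/

section Ultrapower

variable (ω : Ultrafilter ℕ) (A : Type*) [CStarAlgebra A]

/-- The ideal of the bounded sequences `a` in `A` with `lim_{n → ω} ‖a_n‖_{2,T(A)} = 0`. -/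
def traceKernelIdeal : Ideal (ℕ →ᵇ A) where
  carrier := {a | Tendsto (fun n => uniformTraceNorm (a n)) ω (𝓝 0)}
  zero_mem' := by simp [uniformTraceNorm_zero]
  add_mem' {a b} ha hb := by
    refine squeeze_zero (fun _ => uniformTraceNorm_nonneg _)
      (fun n => uniformTraceNorm_add (a n) (b n)) ?_
    simpa using (Tendsto.add ha hb).const_mul 2
  smul_mem' x a ha := by
    refine squeeze_zero (fun _ => uniformTraceNorm_nonneg _)
      (g := fun n => ‖x‖ * uniformTraceNorm (a n)) (fun n => ?_) ?_
    · exact (uniformTraceNorm_mul_left (x n) (a n)).trans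
        (mul_le_mul_of_nonneg_right (x.norm_coe_le_norm n) (uniformTraceNorm_nonneg _))
    · simpa using Tendsto.const_mul ‖x‖ ha

variable {A} in
theorem mem_traceKernelIdeal {a : ℕ →ᵇ A} :
    a ∈ traceKernelIdeal ω A ↔ Tendsto (fun n => uniformTraceNorm (a n)) ω (𝓝 0) :=
  Iff.rfl

instance traceKernelIdeal_isTwoSided : (traceKernelIdeal ω A).IsTwoSided where
  mul_mem_of_left {a} x ha := by
    rw [mem_traceKernelIdeal] at ha ⊢
    refine squeeze_zero (fun _ => uniformTraceNorm_nonneg _)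
      (g := fun n => ‖x‖ * uniformTraceNorm (a n)) (fun n => ?_) ?_
    · exact (uniformTraceNorm_mul_right (a n) (x n)).trans
        (mul_le_mul_of_nonneg_right (x.norm_coe_le_norm n) (uniformTraceNorm_nonneg _))
    · simpa using Tendsto.const_mul ‖x‖ ha

variable {A} in
theorem star_mem_traceKernelIdeal {a : ℕ →ᵇ A} (ha : a ∈ traceKernelIdeal ω A) :
    star a ∈ traceKernelIdeal ω A := by
  rw [mem_traceKernelIdeal] at ha ⊢
  simpa [uniformTraceNorm_star] using ha

/-- The uniform tracial ultrapower `A^ω`: bounded sequences in `A` modulo those that tend to zero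
along `ω` in the uniform 2-seminorm. -/
abbrev TracialUltrapower : Type _ := (ℕ →ᵇ A) ⧸ traceKernelIdeal ω A

variable {A} in
/-- The element of `A^ω` represented by a bounded sequence. -/
abbrev TracialUltrapower.mk : (ℕ →ᵇ A) →+* TracialUltrapower ω A :=
  Ideal.Quotient.mk (traceKernelIdeal ω A)

/-- The involution of `A^ω`, induced by the involution of bounded sequences. -/
instance TracialUltrapower.instStarRing : StarRing (TracialUltrapower ω A) where
  star := Quotient.map' star fun a b h => by
    rw [Submodule.quotientRel_def] at h ⊢
    rw [← star_sub]
    exact star_mem_traceKernelIdeal ω h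
  star_involutive := by
    rintro ⟨a⟩
    exact congrArg (TracialUltrapower.mk ω) (star_star a)
  star_mul := by
    rintro ⟨a⟩ ⟨b⟩
    exact congrArg (TracialUltrapower.mk ω) (star_mul a b)
  star_add := by
    rintro ⟨a⟩ ⟨b⟩
    exact congrArg (TracialUltrapower.mk ω) (star_add a b)

theorem TracialUltrapower.star_mk (a : ℕ →ᵇ A) :
    star (TracialUltrapower.mk ω a) = TracialUltrapower.mk ω (star a) :=
  rfl

variable {A} in
/-- The canonical map `ι : A → A^ω` given by constant sequences. -/
def TracialUltrapower.ι (a : A) : TracialUltrapower ω A :=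
  TracialUltrapower.mk ω (BoundedContinuousFunction.const ℕ a)

variable {A} in
theorem tendsto_limUnder_trace (τ : ℕ → traceSpace A) (a : ℕ →ᵇ A) :
    Tendsto (fun n => (τ n : WeakDual ℂ A) (a n)) ω
      (𝓝 (limUnder (ω : Filter ℕ) fun n => (τ n : WeakDual ℂ A) (a n))) := by
  apply tendsto_nhds_limUnder
  have hmem : ∀ n, (τ n : WeakDual ℂ A) (a n) ∈ Metric.closedBall (0 : ℂ) ‖a‖ := fun n => by
    rw [mem_closedBall_zero_iff]
    exact (norm_trace_le_norm (τ n).2 _).trans (a.norm_coe_le_norm n)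
  obtain ⟨z, -, hz⟩ := (isCompact_closedBall (0 : ℂ) ‖a‖).ultrafilter_le_nhds
    (ω.map fun n => (τ n : WeakDual ℂ A) (a n))
    (le_principal_iff.2 (Filter.mem_map.2 (Eventually.of_forall hmem)))
  exact ⟨z, hz⟩

variable {A} in
/-- The limit trace on `A^ω` given by a sequence `(τ_n)` of traces on `A`: it takes the element
represented by `(a_n)` to `lim_{n → ω} τ_n(a_n)`. -/
def limitTrace (τ : ℕ → traceSpace A) : TracialUltrapower ω A →ₗ[ℂ] ℂ where
  toFun := Quotient.lift
    (fun a : ℕ →ᵇ A => limUnder (ω : Filter ℕ) fun n => (τ n : WeakDual ℂ A) (a n))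
    (fun a b h => by
      have h' : a - b ∈ traceKernelIdeal ω A := (Submodule.quotientRel_def _).1 h
      have h0 : Tendsto (fun n => (τ n : WeakDual ℂ A) ((a - b) n)) ω (𝓝 0) :=
        squeeze_zero_norm (fun n => norm_trace_le (τ n).2 _) h'
      have h1 := (tendsto_limUnder_trace ω τ a).sub (tendsto_limUnder_trace ω τ b)
      have h2 : Tendsto (fun n => (τ n : WeakDual ℂ A) ((a - b) n)) ω
          (𝓝 ((limUnder (ω : Filter ℕ) fun n => (τ n : WeakDual ℂ A) (a n)) -
            limUnder (ω : Filter ℕ) fun n => (τ n : WeakDual ℂ A) (b n))) := by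
        simpa using h1
      exact sub_eq_zero.1 (tendsto_nhds_unique h2 h0))
  map_add' := by
    rintro ⟨a⟩ ⟨b⟩
    refine tendsto_nhds_unique (tendsto_limUnder_trace ω τ (a + b)) ?_
    simpa using (tendsto_limUnder_trace ω τ a).add (tendsto_limUnder_trace ω τ b)
  map_smul' := by
    rintro c ⟨a⟩
    refine tendsto_nhds_unique (tendsto_limUnder_trace ω τ (c • a)) ?_
    simpa using (tendsto_limUnder_trace ω τ a).const_mul c

theorem limitTrace_mk (τ : ℕ → traceSpace A) (a : ℕ →ᵇ A) :
    Tendsto (fun n => (τ n : WeakDual ℂ A) (a n)) ω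
      (𝓝 (limitTrace ω τ (TracialUltrapower.mk ω a))) :=
  tendsto_limUnder_trace ω τ a

/-- `T_ω(A)`: the set of limit traces on `A^ω`. -/
def limitTraces : Set (TracialUltrapower ω A →ₗ[ℂ] ℂ) :=
  Set.range fun τ : ℕ → traceSpace A => limitTrace ω τ

/-- Uniform property Γ of the unital C*-algebra `A`, witnessed in the uniform tracial ultrapower
along the free ultrafilter `ω`; the notion is meant for separable `A`. -/
def HasUniformPropertyGamma : Prop :=
  (traceSpace A).Nonempty ∧ IsCompact (traceSpace A) ∧
    ∀ n : ℕ, 1 ≤ n → ∃ p : Fin n → TracialUltrapower ω A,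
      (∀ i, IsStarProjection (p i)) ∧
      (∀ i, p i ∈ Set.centralizer (Set.range (TracialUltrapower.ι ω : A → _))) ∧
      ∑ i, p i = 1 ∧
      ∀ i, ∀ a : A, ∀ τ ∈ limitTraces ω A,
        τ (TracialUltrapower.ι ω a * p i) = (1 / n : ℂ) * τ (TracialUltrapower.ι ω a)

end Ultrapower

/-! ### Diagonal maps -/

/-- `M_n ⊗ C(X)`, as the C*-algebra of `n × n` matrices over `C(X)`. -/
abbrev MatrixFunctions (n : ℕ) (X : Type*) [TopologicalSpace X] [CompactSpace X] : Type _ :=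
  CStarMatrix (Fin n) (Fin n) C(X, ℂ)

/-- The value of an element of `M_n ⊗ C(X)` at a point of `X`, a complex matrix. -/
def MatrixFunctions.eval {n : ℕ} {X : Type*} [TopologicalSpace X] [CompactSpace X]
    (a : MatrixFunctions n X) (x : X) : Matrix (Fin n) (Fin n) ℂ :=
  Matrix.of fun i j => a i j x

/-- `e` is a (complete) system of matrix units `e_{rs}` of `M_n`. -/
structure IsMatrixUnits {n : ℕ} (e : Fin n → Fin n → Matrix (Fin n) (Fin n) ℂ) : Prop where
  mul_eq : ∀ r s t u, e r s * e t u = if s = t then e r u else 0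
  star_eq : ∀ r s, star (e r s) = e s r
  sum_eq : ∑ r, e r r = 1

/-- The elementary tensor `m ⊗ g` in `M_n ⊗ C(Y)`. -/
def MatrixFunctions.tensor {n : ℕ} {Y : Type*} [TopologicalSpace Y] [CompactSpace Y]
    (m : Matrix (Fin n) (Fin n) ℂ) (g : C(Y, ℂ)) : MatrixFunctions n Y :=
  CStarMatrix.ofMatrix (Matrix.of fun i j => m i j • g)

section Diagonal

variable {X Y : Type*} [TopologicalSpace X] [CompactSpace X] [TopologicalSpace Y] [CompactSpace Y]

/-- A map `C(X) → M_k ⊗ C(Y)` is diagonal: `φ(f) = ∑ r, e_{rr} ⊗ (f ∘ l_r)` for continuous maps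
`l_1, …, l_k : Y → X` and matrix units `e_{rs}` of `M_k`. -/
def IsDiagonal {k : ℕ} (φ : C(X, ℂ) →⋆ₐ[ℂ] MatrixFunctions k Y) : Prop :=
  ∃ (l : Fin k → C(Y, X)) (e : Fin k → Fin k → Matrix (Fin k) (Fin k) ℂ),
    IsMatrixUnits e ∧ ∀ f, φ f = ∑ r, MatrixFunctions.tensor (e r r) (f.comp (l r))

/-- The matrix amplification `id ⊗ φ : M_m ⊗ C(X) → M_m ⊗ M_k ⊗ C(Y)` of a map
`φ : C(X) → M_k ⊗ C(Y)`, applied to `a` and evaluated at `y`; here `M_m ⊗ M_k` is the algebra of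
matrices indexed by pairs. -/
def amplificationAt {m k : ℕ} (φ : C(X, ℂ) →⋆ₐ[ℂ] MatrixFunctions k Y) (a : MatrixFunctions m X)
    (y : Y) : Matrix (Fin m × Fin k) (Fin m × Fin k) ℂ :=
  Matrix.of fun p q => φ (a p.1 q.1) p.2 q.2 y

/-- A map `M_m ⊗ C(X) → M_n ⊗ C(Y)` is diagonal: for some `k` it is the matrix amplification
`M_m ⊗ C(X) → M_m ⊗ M_k ⊗ C(Y)` of a diagonal map `C(X) → M_k ⊗ C(Y)`, followed by an
identification `θ : M_m ⊗ M_k ≅ M_n` (any `*`-isomorphism; in particular `n = m * k`). -/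
def IsDiagonalAmplification {m n : ℕ} (φ : MatrixFunctions m X →⋆ₐ[ℂ] MatrixFunctions n Y) :
    Prop :=
  ∃ (k : ℕ) (φ₀ : C(X, ℂ) →⋆ₐ[ℂ] MatrixFunctions k Y)
    (θ : Matrix (Fin m × Fin k) (Fin m × Fin k) ℂ ≃⋆ₐ[ℂ] Matrix (Fin n) (Fin n) ℂ),
    IsDiagonal φ₀ ∧ ∀ a y, (φ a).eval y = θ (amplificationAt φ₀ a y)

end Diagonal

/-! ### Inductive limits of sequences of C*-algebras -/

section InductiveLimit

variable {B : ℕ → Type*} [∀ i, CStarAlgebra (B i)]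

/-- The composed connecting map `φ_{i+j-1} ∘ ⋯ ∘ φ_i : B_i → B_{i+j}`. -/
def connectingMap (φ : ∀ i, B i →⋆ₐ[ℂ] B (i + 1)) (i : ℕ) : ∀ j, B i →⋆ₐ[ℂ] B (i + j)
  | 0 => StarAlgHom.id ℂ (B i)
  | j + 1 => (φ (i + j)).comp (connectingMap φ i j)

/-- `A`, with the canonical maps `μ_i : B_i → A`, is the C*-algebra inductive limit of the sequence
`B_0 → B_1 → ⋯` with connecting maps `φ_i`: the maps `μ_i` are compatible with the `φ_i`, the union
of their ranges is dense, and `‖μ_i(b)‖ = lim_j ‖φ_{i+j-1} ⋯ φ_i(b)‖`, so that `A` is the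
completion of the algebraic direct limit in its limit C*-seminorm. -/
structure IsInductiveLimit (φ : ∀ i, B i →⋆ₐ[ℂ] B (i + 1)) {A : Type*} [CStarAlgebra A]
    (μ : ∀ i, B i →⋆ₐ[ℂ] A) : Prop where
  compatible : ∀ i, (μ (i + 1)).comp (φ i) = μ i
  dense : Dense (⋃ i, Set.range (μ i))
  norm_eq : ∀ i b, Tendsto (fun j => ‖connectingMap φ i j b‖) atTop (𝓝 ‖μ i b‖)

end InductiveLimit

end

/-! The range of a diagonal map `M_m ⊗ C(X) → M_m ⊗ M_k ⊗ C(Y)` commutes with the projections `1 ⊗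
e_rr`. The matrix units make these `k` projections equivalent, so every trace gives them equal
value. Such partitions multiply under composition, and since `n_i → ∞` the number `k` of pieces over
a fixed stage is unbounded. Grouping the pieces into `N` nearly equal families gives projections in
`A` that sum to 1, commute with the `m`-th building block and have trace within `1/(m+1)` of `1/N`
(`IsInductiveLimit.exists_partition`). By density they are asymptotically central.

It remains to see that `τ(a e) ≈ τ(a)/N` uniformly in `τ`, and here the Bauer condition enters. If
the `τ_m` are extreme, so is their ultralimit `ρ`, by compactness. The functional `σ(b) = lim
τ_m(e_m b)` is tracial by asymptotic centrality and satisfies `0 ≤ σ ≤ ρ`, so extremality forces `σ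
= σ(1) ρ` (`eq_smul_of_le_extreme_trace`, `tendsto_extreme_trace_mul_sub`). Krein–Milman carries the
estimate from extreme traces to all traces (`tendsto_trace_mul_sub`). -/

noncomputable section

/-! ### The trace simplex and its extreme points -/

section TraceSimplex

variable {A : Type*} [CStarAlgebra A]

theorem weakDual_real_smul_apply (r : ℝ) (τ : WeakDual ℂ A) (a : A) :
    (r • τ) a = (r : ℂ) * τ a :=
  Complex.ext rfl rfl

theorem weakDual_real_smul_add_smul_apply (s t : ℝ) (τ σ : WeakDual ℂ A) (a : A) :
    (s • τ + t • σ) a = (s : ℂ) * τ a + (t : ℂ) * σ a := by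
  rw [← weakDual_real_smul_apply, ← weakDual_real_smul_apply]; rfl

theorem convex_traceSpace : Convex ℝ (traceSpace A) := by
  rintro τ ⟨h1, h2, h3⟩ σ ⟨k1, k2, k3⟩ s t hs ht hst
  have e := weakDual_real_smul_add_smul_apply s t τ σ
  refine ⟨fun a => ?_, ?_, fun a b => ?_⟩
  · rw [e]
    exact add_nonneg (mul_nonneg (by exact_mod_cast hs) (h1 a))
      (mul_nonneg (by exact_mod_cast ht) (k1 a))
  · rw [e, h2, k2]
    simpa using (by exact_mod_cast hst : (s : ℂ) + t = 1)
  · rw [e, e, h3, k3]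

theorem isCompact_traceSpace : IsCompact (traceSpace A) := by
  refine WeakDual.isCompact_of_bounded_of_closed ?_ ?_
  · refine (WeakDual.isBounded_closedBall (0 : StrongDual ℂ A) 1).subset fun τ hτ => ?_
    rw [Set.mem_preimage, mem_closedBall_zero_iff]
    exact ContinuousLinearMap.opNorm_le_bound _ zero_le_one fun a => by
      rw [one_mul]; exact norm_trace_le_norm hτ a
  · have h : traceSpace A = (⋂ a, {τ : WeakDual ℂ A | 0 ≤ τ (star a * a)}) ∩
        ({τ : WeakDual ℂ A | τ 1 = 1} ∩ ⋂ a, ⋂ b, {τ : WeakDual ℂ A | τ (a * b) = τ (b * a)}) := by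
      ext τ; simp [traceSpace]
    rw [h]
    refine (isClosed_iInter fun a => ?_).inter (IsClosed.inter ?_ <|
      isClosed_iInter fun a => isClosed_iInter fun b => ?_)
    · exact isClosed_le continuous_const (WeakDual.eval_continuous _)
    · exact isClosed_eq (WeakDual.eval_continuous _) continuous_const
    · exact isClosed_eq (WeakDual.eval_continuous _) (WeakDual.eval_continuous _)

/-- Krein–Milman, for the real structure that the dual inherits from its complex one. -/
theorem closure_convexHull_extremePoints_traceSpace :
    closure (convexHull ℝ ((traceSpace A).extremePoints ℝ)) = traceSpace A :=
  @closure_convexHull_extremePoints (WeakDual ℂ A) _ (Module.complexToReal _) _ _ _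
    (WeakDual.instContinuousSMul ℝ) (WeakBilin.locallyConvexSpace (B := topDualPairing ℂ A)) _
    isCompact_traceSpace convex_traceSpace

/-- A bound for `|τ x|` on the extreme traces holds on all traces. -/
theorem norm_trace_le_of_extremePoints {x : A} {c : ℝ}
    (h : ∀ τ ∈ (traceSpace A).extremePoints ℝ, ‖τ x‖ ≤ c) {τ : WeakDual ℂ A}
    (hτ : τ ∈ traceSpace A) : ‖τ x‖ ≤ c := by
  rw [← closure_convexHull_extremePoints_traceSpace] at hτ
  refine closure_minimal (t := {σ : WeakDual ℂ A | ‖σ x‖ ≤ c}) (convexHull_min h ?_)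
    (isClosed_le (WeakDual.eval_continuous x).norm continuous_const) hτ
  intro σ hσ ρ hρ s t hs ht hst
  change ‖σ x‖ ≤ c at hσ
  change ‖ρ x‖ ≤ c at hρ
  change ‖(s : ℂ) * σ x + (t : ℂ) * ρ x‖ ≤ c
  refine (norm_add_le _ _).trans ?_
  rw [norm_mul, norm_mul, Complex.norm_real, Complex.norm_real, Real.norm_of_nonneg hs,
    Real.norm_of_nonneg ht]
  calc s * ‖σ x‖ + t * ‖ρ x‖ ≤ s * c + t * c := by gcongr
    _ = c := by rw [← add_mul, hst, one_mul]

/-- A tracial positive functional dominated by an extreme trace is a multiple of it. -/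
theorem eq_smul_of_le_extreme_trace {τ σ : WeakDual ℂ A}
    (hτ : τ ∈ (traceSpace A).extremePoints ℝ) (hσ : ∀ a b, σ (a * b) = σ (b * a))
    (h0 : ∀ a, 0 ≤ σ (star a * a)) (h1 : ∀ a, σ (star a * a) ≤ τ (star a * a)) (b : A) :
    σ b = σ 1 * τ b := by
  obtain ⟨hT, hext⟩ := mem_extremePoints_iff_left.1 hτ
  obtain ⟨s, hs⟩ : ∃ s : ℝ, σ 1 = s := by
    have := h0 1
    rw [star_one, one_mul] at this
    exact ⟨(σ 1).re, Complex.ext rfl (Complex.le_def.1 this).2.symm⟩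
  have hs0 : 0 ≤ s := by have := h0 1; rw [star_one, one_mul, hs] at this; exact_mod_cast this
  have hs1 : s ≤ 1 := by
    have := h1 1
    rw [star_one, one_mul, hs, hT.2.1] at this; exact_mod_cast this
  -- Normalizing `σ` and `τ - σ` themselves would require `0 < s < 1`. Adding `τ` to each gives
  -- masses `1 + s` and `2 - s`, which are positive for all `s` in `[0, 1]`; the two functionals add
  -- up to `3τ`, whence the weights `(1 + s)/3` and `(2 - s)/3` below.
  have hp : 0 < 1 + s := by linarith
  have hm : 0 < 2 - s := by linarith
  have e1 : ∀ a, ((1 + s)⁻¹ • (τ + σ)) a = ((1 + s)⁻¹ : ℝ) * (τ a + σ a) := fun a => by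
    rw [weakDual_real_smul_apply]; rfl
  have e2 : ∀ a, ((2 - s)⁻¹ • (τ + (τ - σ))) a = ((2 - s)⁻¹ : ℝ) * (τ a + (τ a - σ a)) :=
    fun a => by rw [weakDual_real_smul_apply]; rfl
  have hmem1 : (1 + s)⁻¹ • (τ + σ) ∈ traceSpace A := by
    refine ⟨fun a => ?_, ?_, fun a b => ?_⟩
    · rw [e1]
      exact mul_nonneg (by exact_mod_cast (inv_pos.2 hp).le) (add_nonneg (hT.1 a) (h0 a))
    · rw [e1, hT.2.1, hs]
      exact_mod_cast inv_mul_cancel₀ hp.ne'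
    · rw [e1, e1, hT.2.2, hσ]
  have hmem2 : (2 - s)⁻¹ • (τ + (τ - σ)) ∈ traceSpace A := by
    refine ⟨fun a => ?_, ?_, fun a b => ?_⟩
    · rw [e2]
      exact mul_nonneg (by exact_mod_cast (inv_pos.2 hm).le)
        (add_nonneg (hT.1 a) (sub_nonneg.2 (h1 a)))
    · rw [e2, hT.2.1, hs]
      have : (2 - s)⁻¹ * (1 + (1 - s)) = 1 := by field_simp; ring
      exact_mod_cast this
    · rw [e2, e2, hT.2.2, hσ]
  have hseg : τ ∈ openSegment ℝ ((1 + s)⁻¹ • (τ + σ)) ((2 - s)⁻¹ • (τ + (τ - σ))) := by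
    refine ⟨(1 + s) / 3, (2 - s) / 3, by positivity, by positivity, by ring, ?_⟩
    have hp' : (1 + s : ℂ) ≠ 0 := by exact_mod_cast hp.ne'
    have hm' : (2 - s : ℂ) ≠ 0 := by exact_mod_cast hm.ne'
    refine DFunLike.ext _ _ fun a => ?_
    refine (weakDual_real_smul_add_smul_apply _ _ _ _ a).trans ?_
    rw [e1, e2]
    push_cast
    field_simp
    ring
  have key := congrArg (fun ρ : WeakDual ℂ A => ρ b) (hext _ hmem1 _ hmem2 hseg)
  simp only [e1] at key
  have hc : ((1 + s : ℝ) : ℂ) ≠ 0 := by exact_mod_cast hp.ne'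
  rw [Complex.ofReal_inv, inv_mul_eq_iff_eq_mul₀ hc] at key
  rw [hs]
  push_cast at key
  linear_combination key

end TraceSimplex
/-! ### Equal partitions in the relative commutant -/

section EqualPartition

/-- The codomain of `φ` contains `k` orthogonal projections with sum `1` that commute with the
range of `φ` and that have the same value under every tracial functional. -/
def HasEqualPartition {B C : Type*} [CStarAlgebra B] [CStarAlgebra C] (φ : B →⋆ₐ[ℂ] C) (k : ℕ) :
    Prop :=
  ∃ q : Fin k → C, (∀ r, IsStarProjection (q r)) ∧ (∀ r s, r ≠ s → q r * q s = 0) ∧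
    ∑ r, q r = 1 ∧ (∀ r b, Commute (q r) (φ b)) ∧
    ∀ t : C →ₗ[ℂ] ℂ, (∀ x y, t (x * y) = t (y * x)) → ∀ r, (k : ℂ) * t (q r) = t 1

variable {B C D : Type*} [CStarAlgebra B] [CStarAlgebra C] [CStarAlgebra D]

theorem hasEqualPartition_one (φ : B →⋆ₐ[ℂ] C) : HasEqualPartition φ 1 :=
  ⟨fun _ => 1, fun _ => .one C, fun r s h => (h (Subsingleton.elim r s)).elim, by simp,
    fun _ _ => Commute.one_left _, by simp⟩

/-- The products `ψ(q_r) p_s` work because each `p_s` commutes with the range of `ψ`. -/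
theorem HasEqualPartition.comp {ψ : C →⋆ₐ[ℂ] D} {φ : B →⋆ₐ[ℂ] C} {k l : ℕ}
    (hφ : HasEqualPartition φ k) (hψ : HasEqualPartition ψ l) :
    HasEqualPartition (ψ.comp φ) (k * l) := by
  obtain ⟨q, q1, q2, q3, q4, q5⟩ := hφ
  obtain ⟨p, p1, p2, p3, p4, p5⟩ := hψ
  have hmul : ∀ r s r' s', ψ (q r) * p s * (ψ (q r') * p s') = ψ (q r * q r') * (p s * p s') :=
    fun r s r' s' => by
      rw [map_mul, mul_assoc, ← mul_assoc (p s), (p4 s (q r')).eq]; simp only [mul_assoc]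
  refine ⟨fun i => ψ (q (finProdFinEquiv.symm i).1) * p (finProdFinEquiv.symm i).2,
    fun i => ?_, fun i j hij => ?_, ?_, fun i b => ?_, fun t ht i => ?_⟩
  · exact ((q1 _).map ψ).mul (p1 _) (p4 _ _).symm
  · rw [hmul]
    by_cases h : (finProdFinEquiv.symm i).1 = (finProdFinEquiv.symm j).1
    · rw [p2 _ _ fun h' => hij (finProdFinEquiv.symm.injective (Prod.ext h h')), mul_zero]
    · rw [q2 _ _ h, map_zero, zero_mul]
  · rw [finProdFinEquiv.symm.sum_comp fun x => ψ (q x.1) * p x.2, Fintype.sum_prod_type]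
    simp_rw [← Finset.mul_sum, p3, mul_one, ← map_sum, q3, map_one]
  · exact ((q4 _ b).map ψ).mul_left (p4 _ _)
  -- The functional `x ↦ t(ψ(x) p_s)` is tracial since `p_s` commutes with `ψ(C)`, but it is not
  -- normalized; hence the partition property is stated for all tracial functionals.
  · have h := q5 (t ∘ₗ LinearMap.mulRight ℂ (p (finProdFinEquiv.symm i).2) ∘ₗ
      (ψ : C →ₗ[ℂ] D)) (fun x y => ?_) (finProdFinEquiv.symm i).1
    · simp only [LinearMap.comp_apply, LinearMap.mulRight_apply] at h
      have h' := p5 t ht (finProdFinEquiv.symm i).2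
      change _ * t (ψ _ * _) = t (ψ 1 * _) at h
      rw [map_one, one_mul] at h
      rw [← h', ← h]
      push_cast
      ring
    · change t (ψ (x * y) * p _) = t (ψ (y * x) * p _)
      rw [map_mul ψ, map_mul ψ, mul_assoc, ht, mul_assoc, (p4 _ _).eq, mul_assoc]

end EqualPartition

/-! ### Equal partitions for diagonal maps -/

section Diagonal

variable {X Y : Type*} [TopologicalSpace X] [CompactSpace X] [TopologicalSpace Y] [CompactSpace Y]

namespace MatrixFunctions

variable {n : ℕ}

theorem eval_injective {a b : MatrixFunctions n Y} (h : ∀ y, a.eval y = b.eval y) : a = b :=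
  CStarMatrix.ext fun i j => ContinuousMap.ext fun y => congrFun (congrFun (h y) i) j

theorem eval_mul (a b : MatrixFunctions n Y) (y : Y) : eval (a * b) y = a.eval y * b.eval y := by
  ext i j
  simp [eval, CStarMatrix.mul_apply, Matrix.mul_apply]

theorem sum_apply {κ : Type*} (s : Finset κ) (f : κ → MatrixFunctions n Y) (i j : Fin n) (y : Y) :
    (∑ r ∈ s, f r) i j y = ∑ r ∈ s, f r i j y := by
  classical
  induction s using Finset.induction_on with
  | empty => simp [CStarMatrix.zero_apply]
  | insert r s hr ih =>
    rw [Finset.sum_insert hr, Finset.sum_insert hr, CStarMatrix.add_apply, ContinuousMap.add_apply,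
      ih]

/-- The embedding of `M_n` into `M_n ⊗ C(Y)` as constant functions. -/
def const (Y : Type*) [TopologicalSpace Y] [CompactSpace Y] :
    Matrix (Fin n) (Fin n) ℂ →+* MatrixFunctions n Y where
  toFun m := tensor m 1
  map_one' := eval_injective fun y => by
    ext i j
    by_cases h : i = j <;> simp [eval, tensor, CStarMatrix.one_apply, Matrix.one_apply, h]
  map_zero' := eval_injective fun y => by ext i j; simp [eval, tensor, CStarMatrix.zero_apply]
  map_add' a b := eval_injective fun y => by ext i j; simp [eval, tensor]
  map_mul' a b := eval_injective fun y => by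
    ext i j; simp [eval, tensor, CStarMatrix.mul_apply, Matrix.mul_apply, mul_comm]

theorem eval_const (m : Matrix (Fin n) (Fin n) ℂ) (y : Y) : (const Y m).eval y = m := by
  ext i j; simp [eval, tensor, const]

theorem const_star (m : Matrix (Fin n) (Fin n) ℂ) : const Y (star m) = star (const Y m) := by
  refine eval_injective fun y => ?_
  ext i j; simp [eval, tensor, const, CStarMatrix.star_apply]

end MatrixFunctions

open Kronecker in
-- The projections are the constant functions `θ(1 ⊗ e_rr)`; the off-diagonal units serve to compare
-- their traces.
theorem IsDiagonalAmplification.exists_hasEqualPartition {m n : ℕ}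
    {φ : MatrixFunctions m X →⋆ₐ[ℂ] MatrixFunctions n Y} (hφ : IsDiagonalAmplification φ) :
    ∃ k, n = m * k ∧ HasEqualPartition φ k := by
  obtain ⟨k, φ₀, θ, ⟨l, e, he, hφ₀⟩, hθ⟩ := hφ
  refine ⟨k, ?_, ?_⟩
  -- Comparing dimensions across `θ` gives `(mk)² = n²`.
  · have h : Module.finrank ℂ (Matrix (Fin m × Fin k) (Fin m × Fin k) ℂ) =
        Module.finrank ℂ (Matrix (Fin n) (Fin n) ℂ) :=
      LinearEquiv.finrank_eq (AlgEquiv.toLinearEquiv (StarAlgEquiv.toAlgEquiv θ))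
    simp only [Module.finrank_matrix, Fintype.card_prod, Fintype.card_fin, Module.finrank_self,
      mul_one] at h
    exact (Nat.mul_self_inj.1 h).symm
  · let u : Fin k → Fin k → MatrixFunctions n Y := fun r s =>
      MatrixFunctions.const Y (θ ((1 : Matrix (Fin m) (Fin m) ℂ) ⊗ₖ e r s))
    have hu : ∀ r s t v, u r s * u t v = if s = t then u r v else 0 := fun r s t v => by
      simp only [u]
      rw [← map_mul, ← map_mul, ← Matrix.mul_kronecker_mul, one_mul, he.mul_eq]
      split_ifs
      · rfl
      · rw [Matrix.kronecker_zero, map_zero, map_zero]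
    have hustar : ∀ r s, star (u r s) = u s r := fun r s => by
      simp only [u]
      rw [← MatrixFunctions.const_star, ← map_star, Matrix.star_eq_conjTranspose,
        Matrix.conjTranspose_kronecker, Matrix.conjTranspose_one, ← Matrix.star_eq_conjTranspose,
        he.star_eq]
    have husum : ∑ r, u r r = 1 := by
      simp only [u]
      rw [← map_sum, ← map_sum]
      have : ∑ r, (1 : Matrix (Fin m) (Fin m) ℂ) ⊗ₖ e r r = 1 := by
        rw [← Matrix.one_kronecker_one, ← he.sum_eq]
        ext p q
        simp [Matrix.sum_apply, Finset.mul_sum]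
      rw [this, map_one, map_one]
    refine ⟨fun r => u r r, fun r => ⟨?_, ?_⟩, fun r s h => ?_, husum, fun r b => ?_,
      fun t ht r => ?_⟩
    · exact (hu r r r r).trans (if_pos rfl)
    · exact hustar r r
    · exact (hu _ _ _ _).trans (if_neg h)
    · refine MatrixFunctions.eval_injective fun y => ?_
      simp only [MatrixFunctions.eval_mul, u, MatrixFunctions.eval_const, hθ]
      rw [← map_mul, ← map_mul]
      congr 1
      -- In this block-diagonal form, multiplying by `1 ⊗ e_rr` on either side keeps only the `r`-th
      -- summand.
      have hamp : amplificationAt φ₀ b y =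
          ∑ s, (b.eval (l s y)) ⊗ₖ e s s := by
        ext p q
        simp [amplificationAt, hφ₀, MatrixFunctions.sum_apply, MatrixFunctions.tensor,
          MatrixFunctions.eval, Matrix.sum_apply, mul_comm]
      rw [hamp, Finset.mul_sum, Finset.sum_mul]
      refine Finset.sum_congr rfl fun s _ => ?_
      rw [← Matrix.mul_kronecker_mul, ← Matrix.mul_kronecker_mul, one_mul, mul_one, he.mul_eq,
        he.mul_eq]
      by_cases h : r = s
      · subst h; rfl
      · rw [if_neg h, if_neg (Ne.symm h)]
    -- `u_ss = u_sr u_rs` and `u_rr = u_rs u_sr` agree under `t`.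
    · have h : ∀ s, t (u s s) = t (u r r) := fun s => by
        have h1 := hu s r r s
        have h2 := hu r s s r
        rw [if_pos rfl] at h1 h2
        rw [← h1, ht, h2]
      rw [← husum, map_sum, Finset.sum_congr rfl fun s _ => h s]
      simp

end Diagonal
-- Grouping into `N` nearly equal pieces
section Grouping

/-- A residue class modulo `n` in `{0, …, k-1}` has `⌊k/n⌋` or `⌊k/n⌋ + 1` elements, hence is within
1 of `k/n`. -/
theorem abs_card_mod_div_sub_le {k n : ℕ} (hk : 0 < k) (hn : 0 < n) (i : Fin n) :
    |((Finset.univ.filter fun r : Fin k => r.val % n = i).card : ℝ) / k - 1 / n| ≤ 1 / k := by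
  have hcard : (Finset.univ.filter fun r : Fin k => r.val % n = i).card =
      k / n + if (i : ℕ) % n < k % n then 1 else 0 := by
    rw [← Nat.count_modEq_card k hn, Nat.count_eq_card_filter_range, Finset.card_filter,
      Finset.card_filter, Fin.sum_univ_eq_sum_range fun r => if r % n = (i : ℕ) then 1 else 0]
    simp only [Nat.ModEq, Nat.mod_eq_of_lt i.2]
  have hk' : (0 : ℝ) < k := by exact_mod_cast hk
  have hn' : (0 : ℝ) < n := by exact_mod_cast hn
  have h1 : ((k / n : ℕ) : ℝ) ≤ k / n := Nat.cast_div_le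
  have h2 : (k : ℝ) / n < (k / n : ℕ) + 1 := by
    rw [div_lt_iff₀ hn']
    exact_mod_cast Nat.lt_mul_of_div_lt (Nat.lt_succ_self _) hn
  have h3 : ((Finset.univ.filter fun r : Fin k => r.val % n = i).card : ℝ) / k - 1 / n =
      ((Finset.univ.filter fun r : Fin k => r.val % n = i).card - (k : ℝ) / n) / k := by
    field_simp
  rw [h3, abs_div, abs_of_pos hk', hcard]
  refine div_le_div_of_nonneg_right (abs_le.2 ?_) hk'.le
  split_ifs <;> push_cast <;> constructor <;> linarith

variable {B C : Type*} [CStarAlgebra B] [CStarAlgebra C]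

theorem HasEqualPartition.exists_partition {φ : B →⋆ₐ[ℂ] C} {k : ℕ} (h : HasEqualPartition φ k)
    (hk : 0 < k) {n : ℕ} (hn : 0 < n) :
    ∃ e : Fin n → C, (∀ i, IsStarProjection (e i)) ∧ ∑ i, e i = 1 ∧
      (∀ i b, Commute (e i) (φ b)) ∧
      ∀ t : C →ₗ[ℂ] ℂ, (∀ x y, t (x * y) = t (y * x)) → t 1 = 1 →
        ∀ i, ‖t (e i) - 1 / n‖ ≤ 1 / k := by
  obtain ⟨q, q1, q2, q3, q4, q5⟩ := h
  refine ⟨fun i => ∑ r with r.val % n = i, q r, fun i => ⟨?_, ?_⟩, ?_,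
    fun i b => Commute.sum_left _ _ _ fun r _ => q4 r b, fun t ht ht1 i => ?_⟩
  · change _ * _ = _
    rw [Finset.sum_mul_sum]
    refine Finset.sum_congr rfl fun r hr => ?_
    rw [Finset.sum_eq_single_of_mem r hr fun s _ hs => q2 r s hs.symm]
    exact (q1 r).isIdempotentElem
  · change star _ = _
    rw [star_sum]
    exact Finset.sum_congr rfl fun r _ => (q1 r).isSelfAdjoint
  · rw [← q3, ← Finset.sum_fiberwise Finset.univ
      (fun r : Fin k => (⟨r.val % n, Nat.mod_lt _ hn⟩ : Fin n)) q]
    simp only [Fin.ext_iff]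
  · have hk' : (k : ℂ) ≠ 0 := by exact_mod_cast hk.ne'
    have hq : ∀ r, t (q r) = (k : ℂ)⁻¹ := fun r => by
      exact eq_inv_of_mul_eq_one_right ((q5 t ht r).trans ht1)
    have := abs_card_mod_div_sub_le hk hn i
    rw [← Real.norm_eq_abs, ← Complex.norm_real] at this
    refine le_trans (le_of_eq ?_) this
    rw [map_sum, Finset.sum_congr rfl fun r _ => hq r, Finset.sum_const, nsmul_eq_mul]
    push_cast
    rw [div_eq_mul_inv _ (k : ℂ)]

end Grouping

/-! ### Asymptotically central partitions in the inductive limit -/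

section Limit

variable {B : ℕ → Type*} [∀ i, CStarAlgebra (B i)] {φ : ∀ i, B i →⋆ₐ[ℂ] B (i + 1)}
  {A : Type*} [CStarAlgebra A] {μ : ∀ i, B i →⋆ₐ[ℂ] A}

theorem IsInductiveLimit.map_connectingMap (hA : IsInductiveLimit φ μ) (i j : ℕ) (b : B i) :
    μ (i + j) (connectingMap φ i j b) = μ i b := by
  induction j with
  | zero => rfl
  | succ j ih =>
    rw [← ih]
    exact DFunLike.congr_fun (hA.compatible (i + j)) (connectingMap φ i j b)

theorem IsInductiveLimit.range_mono (hA : IsInductiveLimit φ μ) {i m : ℕ} (h : i ≤ m) :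
    Set.range (μ i) ⊆ Set.range (μ m) := by
  obtain ⟨j, rfl⟩ := Nat.exists_eq_add_of_le h
  rintro _ ⟨b, rfl⟩
  exact ⟨_, hA.map_connectingMap i j b⟩

/-- Bounded sequences that eventually commute with each building block are asymptotically
central. -/
theorem IsInductiveLimit.tendsto_commutator (hA : IsInductiveLimit φ μ) {e : ℕ → A}
    (he : ∀ m, ‖e m‖ ≤ 1) (hcomm : ∀ m b, Commute (e m) (μ m b)) (a : A) :
    Tendsto (fun m => ‖a * e m - e m * a‖) atTop (𝓝 0) := by
  rw [Metric.tendsto_atTop]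
  intro ε hε
  obtain ⟨x, hx, hax⟩ := Metric.mem_closure_iff.1 (hA.dense a) (ε / 2) (by positivity)
  obtain ⟨i, hi⟩ := Set.mem_iUnion.1 hx
  refine ⟨i, fun m hm => ?_⟩
  obtain ⟨b, rfl⟩ := hA.range_mono hm hi
  rw [dist_zero_right, norm_norm]
  -- Only the error `a - μ_m(b)`, of norm below `ε/2`, contributes to the commutator.
  have h : a * e m - e m * a = (a - μ m b) * e m - e m * (a - μ m b) := by
    rw [sub_mul, mul_sub, (hcomm m b).eq]; abel
  rw [dist_eq_norm] at hax
  rw [h]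
  refine (norm_sub_le _ _).trans_lt ?_
  have h1 := norm_mul_le (a - μ m b) (e m)
  have h2 := norm_mul_le (e m) (a - μ m b)
  nlinarith [he m, norm_nonneg (a - μ m b)]

theorem exists_hasEqualPartition_connectingMap {n : ℕ → ℕ}
    (h : ∀ i, ∃ k, n (i + 1) = n i * k ∧ HasEqualPartition (φ i) k) (i j : ℕ) :
    ∃ k, n (i + j) = n i * k ∧ HasEqualPartition (connectingMap φ i j) k := by
  induction j with
  | zero => exact ⟨1, (mul_one _).symm, hasEqualPartition_one _⟩
  | succ j ih =>
    obtain ⟨k, hk, hP⟩ := ih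
    obtain ⟨l, hl, hQ⟩ := h (i + j)
    exact ⟨k * l, by rw [← add_assoc, hl, hk, mul_assoc], hP.comp hQ⟩

/-- Partitions of unity in `A` that commute with a given building block and that divide all traces
almost equally. -/
theorem IsInductiveLimit.exists_partition (hA : IsInductiveLimit φ μ) {n : ℕ → ℕ}
    (hn : Tendsto n atTop atTop)
    (h : ∀ i, ∃ k, n (i + 1) = n i * k ∧ HasEqualPartition (φ i) k) {N : ℕ} (hN : 0 < N) (m : ℕ) :
    ∃ e : Fin N → A, (∀ i, IsStarProjection (e i)) ∧ ∑ i, e i = 1 ∧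
      (∀ i b, Commute (e i) (μ m b)) ∧
      ∀ τ ∈ traceSpace A, ∀ i, ‖τ (e i) - 1 / N‖ ≤ 1 / ((m : ℝ) + 1) := by
  -- As `n M = n m * k`, this forces `k > m + 1`. The `+ 1` makes the inequality strict, so that `n
  -- m` cancels without a positivity hypothesis.
  obtain ⟨M, hmM, hM⟩ : ∃ M ≥ m, n m * (m + 1) + 1 ≤ n M :=
    ((eventually_ge_atTop m).and (hn.eventually_ge_atTop _)).exists
  obtain ⟨j, rfl⟩ := Nat.exists_eq_add_of_le hmM
  obtain ⟨k, hk, hP⟩ := exists_hasEqualPartition_connectingMap h m j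
  have hmk : m + 1 ≤ k := by
    rw [hk] at hM
    exact (Nat.lt_of_mul_lt_mul_left (Nat.lt_of_succ_le hM)).le
  obtain ⟨e, e1, e2, e3, e4⟩ := hP.exists_partition (by omega) hN
  refine ⟨fun i => μ (m + j) (e i), fun i => (e1 i).map _, ?_, fun i b => ?_, fun τ hτ i => ?_⟩
  · rw [← map_sum, e2, map_one]
  · rw [← hA.map_connectingMap m j b]
    exact (e3 i b).map _
  -- A trace on `A` pulls back to a normalized tracial functional on the building block.
  · refine (e4 (τ.toLinearMap ∘ₗ (μ (m + j) : B (m + j) →ₗ[ℂ] A)) (fun x y => ?_) ?_ i).trans ?_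
    · change τ (μ _ (x * y)) = τ (μ _ (y * x))
      rw [map_mul (μ _), map_mul (μ _), hτ.2.2]
    · change τ (μ _ 1) = 1
      rw [map_one, hτ.2.1]
    · have : ((m : ℝ) + 1) ≤ k := by exact_mod_cast hmk
      exact one_div_le_one_div_of_le (by positivity) this

end Limit

/-! ### Asymptotic independence and property Γ -/

section Extreme

variable {A : Type*} [CStarAlgebra A]

/-- By traciality and `e² = e`, the value is `τ((be)*(be))`. Applied to `e` and to `1 - e`, this
gives `0 ≤ σ ≤ ρ` below. -/
theorem trace_projection_mul_nonneg {τ : WeakDual ℂ A} (hτ : τ ∈ traceSpace A) {e : A}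
    (he : IsStarProjection e) (b : A) : 0 ≤ τ (e * (star b * b)) := by
  have h := hτ.1 (b * e)
  rw [star_mul, he.isSelfAdjoint.star_eq, ← mul_assoc, hτ.2.2, ← mul_assoc, ← mul_assoc,
    he.isIdempotentElem.eq] at h
  rwa [← mul_assoc]

/-- If the extreme traces form a compact set, then asymptotically central projections are
asymptotically independent of `A` under extreme traces. -/
theorem tendsto_extreme_trace_mul_sub (ω : Ultrafilter ℕ)
    (hK : IsCompact ((traceSpace A).extremePoints ℝ)) {e : ℕ → A}
    (he : ∀ m, IsStarProjection (e m))
    (hcomm : ∀ a, Tendsto (fun m => ‖a * e m - e m * a‖) ω (𝓝 0))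
    (τ : ℕ → WeakDual ℂ A) (hτ : ∀ m, τ m ∈ (traceSpace A).extremePoints ℝ) {c : ℂ}
    (hc : Tendsto (fun m => τ m (e m)) ω (𝓝 c)) (a : A) :
    Tendsto (fun m => τ m (a * e m) - c * τ m a) ω (𝓝 0) := by
  have hT : ∀ m, τ m ∈ traceSpace A := fun m => (hτ m).1
  -- Compactness of the extreme boundary keeps the limit `ρ` extreme.
  obtain ⟨ρ, hρK, hρ⟩ := hK.ultrafilter_le_nhds (ω.map τ)
    (le_principal_iff.2 (Filter.mem_map.2 (Eventually.of_forall hτ)))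
  have hρ' : ∀ b, Tendsto (fun m => τ m b) ω (𝓝 (ρ b)) := fun b =>
    ((WeakDual.eval_continuous b).tendsto ρ).comp hρ
  let E : ℕ →ᵇ A := BoundedContinuousFunction.ofNormedAddCommGroupDiscrete e 1
    fun m => (he m).norm_le
  -- The limit trace supplies the existence of `lim τ_m(e_m b)`, which defines `σ`.
  have hlim := fun b => limitTrace_mk ω A (fun m => ⟨τ m, hT m⟩)
    (E * BoundedContinuousFunction.const ℕ b)
  let L : A → ℂ := fun b => limitTrace ω (fun m => ⟨τ m, hT m⟩)
    (TracialUltrapower.mk ω (E * BoundedContinuousFunction.const ℕ b))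
  have hL : ∀ b, Tendsto (fun m => τ m (e m * b)) ω (𝓝 (L b)) := hlim
  let σ : WeakDual ℂ A := StrongDual.toWeakDual <| LinearMap.mkContinuous
    { toFun := L
      map_add' := fun x y => tendsto_nhds_unique (hL (x + y)) <| by
        simpa [mul_add] using (hL x).add (hL y)
      map_smul' := fun z x => tendsto_nhds_unique (hL (z • x)) <| by
        simpa using (hL x).const_mul z } 1 fun b => by
      refine le_of_tendsto (hL b).norm (Eventually.of_forall fun m => ?_)
      refine (norm_trace_le_norm (hT m) _).trans ((norm_mul_le _ _).trans ?_)
      exact mul_le_mul_of_nonneg_right (he m).norm_le (norm_nonneg b)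
  have hσ : ∀ b, Tendsto (fun m => τ m (e m * b)) ω (𝓝 (σ b)) := hL
  have hσ1 : σ 1 = c := tendsto_nhds_unique (hσ 1) (by simpa using hc)
  have hswap : ∀ x y, Tendsto (fun m => τ m (x * e m * y) - τ m (e m * x * y)) ω (𝓝 0) :=
    fun x y => by
      refine squeeze_zero_norm (a := fun m => ‖x * e m - e m * x‖ * ‖y‖) (fun m => ?_)
        (by simpa using (hcomm x).mul_const ‖y‖)
      rw [← map_sub, ← sub_mul]
      exact (norm_trace_le_norm (hT m) _).trans (norm_mul_le _ _)
  have htr : ∀ x y, σ (x * y) = σ (y * x) := fun x y => by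
    have h1 := (hσ (y * x)).sub (hσ (x * y))
    refine (sub_eq_zero.1 (tendsto_nhds_unique h1 ((hswap x y).congr fun m => ?_))).symm
    rw [mul_assoc, (hT m).2.2, mul_assoc, mul_assoc]
  have hpos : ∀ b, 0 ≤ σ (star b * b) := fun b =>
    ge_of_tendsto (hσ _) (Eventually.of_forall fun m => trace_projection_mul_nonneg (hT m) (he m) b)
  have hle : ∀ b, σ (star b * b) ≤ ρ (star b * b) := fun b =>
    le_of_tendsto_of_tendsto (hσ _) (hρ' _) (Eventually.of_forall fun m => by
      have := trace_projection_mul_nonneg (hT m) (he m).one_sub b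
      rwa [sub_mul, one_mul, map_sub, sub_nonneg] at this)
  have key := eq_smul_of_le_extreme_trace hρK htr hpos hle a
  rw [hσ1] at key
  have h := (hσ a).sub ((hρ' a).const_mul c)
  rw [key, sub_self] at h
  exact h.congr fun m => by rw [(hT m).2.2]

/-- The conclusion of `tendsto_extreme_trace_mul_sub` for arbitrary traces, for projections of
asymptotically constant trace. -/
theorem tendsto_trace_mul_sub (ω : Ultrafilter ℕ) (hω : (ω : Filter ℕ) ≤ atTop)
    (hK : IsCompact ((traceSpace A).extremePoints ℝ)) {e : ℕ → A}
    (he : ∀ m, IsStarProjection (e m))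
    (hcomm : ∀ a, Tendsto (fun m => ‖a * e m - e m * a‖) ω (𝓝 0)) {c : ℂ}
    (hc : ∀ m, ∀ τ ∈ traceSpace A, ‖τ (e m) - c‖ ≤ 1 / ((m : ℝ) + 1))
    (τ : ℕ → WeakDual ℂ A) (hτ : ∀ m, τ m ∈ traceSpace A) (a : A) :
    Tendsto (fun m => τ m (a * e m) - c * τ m a) ω (𝓝 0) := by
  have h0 : Tendsto (fun m : ℕ => 1 / ((m : ℝ) + 1)) ω (𝓝 0) :=
    tendsto_one_div_add_atTop_nhds_zero_nat.mono_left hω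
  -- An extreme trace nearly as large as `τ_m` on the defect `a e_m - c a`; the slack `1/(m+1)`
  -- avoids having to attain a supremum and vanishes along `ω`.
  have hex : ∀ m, ∃ σ ∈ (traceSpace A).extremePoints ℝ,
      ‖τ m (a * e m - c • a)‖ - 1 / ((m : ℝ) + 1) ≤ ‖σ (a * e m - c • a)‖ := fun m => by
    by_contra! h
    have h1 := norm_trace_le_of_extremePoints (fun σ hσ => (h σ hσ).le) (hτ m)
    have : 0 < 1 / ((m : ℝ) + 1) := by positivity
    linarith
  choose σ hσ hle using hex
  have h1 : Tendsto (fun m => σ m (e m)) ω (𝓝 c) :=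
    tendsto_iff_norm_sub_tendsto_zero.2
      (squeeze_zero (fun _ => norm_nonneg _) (fun m => hc m _ (hσ m).1) h0)
  have h2 := (tendsto_extreme_trace_mul_sub ω hK he hcomm σ hσ h1 a).norm.add h0
  rw [norm_zero, zero_add] at h2
  refine squeeze_zero_norm (fun m => ?_) h2
  have := hle m
  simp only [map_sub, map_smul, smul_eq_mul] at this
  linarith

/-- Uniform property `Γ` from asymptotically central partitions of unity into projections of
asymptotically equal traces, when the extreme traces are compact. -/
theorem hasUniformPropertyGamma_of_partition (ω : Ultrafilter ℕ) (hω : (ω : Filter ℕ) ≤ atTop)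
    (hT : TraceSpaceIsBauer A)
    (h : ∀ N : ℕ, 1 ≤ N → ∃ e : ℕ → Fin N → A, (∀ m i, IsStarProjection (e m i)) ∧
      (∀ m, ∑ i, e m i = 1) ∧
      (∀ i a, Tendsto (fun m => ‖a * e m i - e m i * a‖) atTop (𝓝 0)) ∧
      ∀ m, ∀ τ ∈ traceSpace A, ∀ i, ‖τ (e m i) - 1 / N‖ ≤ 1 / ((m : ℝ) + 1)) :
    HasUniformPropertyGamma ω A := by
  obtain ⟨hK, τ₀, hτ₀⟩ := hT
  refine ⟨⟨τ₀, hτ₀.1⟩, isCompact_traceSpace, fun N hN => ?_⟩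
  obtain ⟨e, he, hsum, hcomm, htr⟩ := h N hN
  let E : Fin N → ℕ →ᵇ A := fun i => BoundedContinuousFunction.ofNormedAddCommGroupDiscrete
    (fun m => e m i) 1 fun m => (he m i).norm_le
  refine ⟨fun i => TracialUltrapower.mk ω (E i), fun i => ⟨?_, ?_⟩, fun i => ?_, ?_, ?_⟩
  · change _ * _ = _
    rw [← map_mul]
    congr 1
    ext m
    exact (he m i).isIdempotentElem
  · change star _ = _
    rw [TracialUltrapower.star_mk]
    congr 1
    ext m
    exact (he m i).isSelfAdjoint
  · rw [Set.mem_centralizer_iff]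
    rintro _ ⟨a, rfl⟩
    rw [TracialUltrapower.ι, ← map_mul, ← map_mul, Ideal.Quotient.eq, mem_traceKernelIdeal]
    -- The operator norm dominates the uniform 2-seminorm.
    exact squeeze_zero (fun _ => uniformTraceNorm_nonneg _)
      (fun m => uniformTraceNorm_le (norm_nonneg _) fun _ hσ => traceSpace_sq_le hσ _)
      ((hcomm i a).mono_left hω)
  · rw [← map_sum, ← map_one (TracialUltrapower.mk ω)]
    congr 1
    ext m
    rw [BoundedContinuousFunction.sum_apply]
    exact hsum m
  · rintro i a _ ⟨τ, rfl⟩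
    have h1 := limitTrace_mk ω A τ (BoundedContinuousFunction.const ℕ a * E i)
    have h2 := limitTrace_mk ω A τ (BoundedContinuousFunction.const ℕ a)
    refine sub_eq_zero.1 (tendsto_nhds_unique (h1.sub (h2.const_mul (1 / N : ℂ))) ?_)
    exact tendsto_trace_mul_sub ω hω hK (fun m => he m i) (fun a => (hcomm i a).mono_left hω)
      (fun m σ hσ => htr m σ hσ i) (fun m => τ m) (fun m => (τ m).2) a

end Extreme
end

theorem proposition5p10 {X : ℕ → Type*} [∀ i, TopologicalSpace (X i)] [∀ i, CompactSpace (X i)]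
    [∀ i, T2Space (X i)] (n : ℕ → ℕ) (hn : Tendsto n atTop atTop)
    (φ : ∀ i, MatrixFunctions (n i) (X i) →⋆ₐ[ℂ] MatrixFunctions (n (i + 1)) (X (i + 1)))
    (hφ : ∀ i, IsDiagonalAmplification (φ i))
    {A : Type*} [CStarAlgebra A] [TopologicalSpace.SeparableSpace A]
    (μ : ∀ i, MatrixFunctions (n i) (X i) →⋆ₐ[ℂ] A) (hA : IsInductiveLimit φ μ)
    (hT : TraceSpaceIsBauer A)
    (ω : Ultrafilter ℕ) (hω : (ω : Filter ℕ) ≤ cofinite) :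
    HasUniformPropertyGamma ω A := by
  refine hasUniformPropertyGamma_of_partition ω (Nat.cofinite_eq_atTop ▸ hω) hT fun N hN => ?_
  -- The stage `m` sets both the block to commute with and the tolerance `1/(m+1)`.
  choose e he hsum hcomm htr using fun m =>
    hA.exists_partition hn (fun i => (hφ i).exists_hasEqualPartition) hN m
  exact ⟨e, he, hsum,
    fun i => hA.tendsto_commutator (fun m => (he m i).norm_le) fun m b => hcomm m i b, htr⟩
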